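/- Let $N$ be a finite (abstract) simplicial complex with vertex set $V$: a collection of nonempty subsets of the finite set $V$, called simplices, that contains $\{v\}$ for every $v \in V$ and contains every nonempty subset of each of its members. Let $|N|$ be its geometric realization, that is, the space of functions $\alpha : V \to [0,1]$ with $\sum_{v \in V} \alpha(v) = 1$ whose support $\{v : \alpha(v) \neq 0\}$ is a simplex of $N$, with the subspace topology from $\mathbb{R}^V$; for a simplex $\sigma \in N$ let $|\sigma| \subset |N|$ be the subset of those $\alpha$ that vanish outside $\sigma$. A metrizable space $Y$ is an absolute neighborhood retract (ANR) if every continuous map $\psi : A \to Y$ from a closed subset $A$ of a metrizable space $X$ extends to a continuous map $\psi' : A' \to Y$ on some open set $A'$ with $A \subset A' \subset X$. Let $L$ be a topological space and $\rho : L \to |N|$ a continuous surjection such that, for every simplex $\sigma \in N$, the preimage $\rho^{-1}(|\sigma|)$, with the subspace topology from $L$, is a contractible ANR. Then $\rho$ has a homotopy inverse $\iota$ with $\iota(|\sigma|) \subset \rho^{-1}(|\sigma|)$ for every $\sigma \in N$; that is, there is a continuous map $\iota : |N| \to L$ such that $\rho \circ \iota$ is homotopic to $\mathrm{id}_{|N|}$,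 $\iota \circ \rho$ is homotopic to $\mathrm{id}_L$, and $\iota(|\sigma|) \subset \rho^{-1}(|\sigma|)$ for every simplex $\sigma \in N$. -/

import Mathlib

/-- The geometric realization `|K|` of a finite simplicial complex `K` with vertex set `V`: the
barycentric functions `α : V → [0, 1]` whose support is a simplex of `K` and whose values sum
to `1`, topologized as a subspace of the finite-dimensional space `V → ℝ`. -/
def AbstractSimplicialComplex.realization {V : Type*} [Fintype V]
    (K : AbstractSimplicialComplex V) : Set (V → ℝ) :=
  {α | (∀ v, α v ∈ Set.Icc (0 : ℝ) 1) ∧ (∃ σ ∈ K, {v | α v ≠ 0} = (σ : Set V)) ∧ ∑ v, α v = 1}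

/-- The realization `|σ| ⊆ |K|` of a simplex `σ`: the barycentric functions in `|K|` that vanish
at every vertex outside `σ`. -/
def AbstractSimplicialComplex.simplexRealization {V : Type*} [Fintype V]
    (K : AbstractSimplicialComplex V) (σ : Finset V) : Set K.realization :=
  {α | ∀ v, v ∉ σ → (α : V → ℝ) v = 0}

/-- `Y` is an absolute neighborhood retract: it is metrizable, and every continuous map to `Y`
from a closed subset `A` of a metrizable space `X` extends continuously to an open set
containing `A`. -/
structure IsANR.{u} (Y : Type u) [TopologicalSpace Y] : Prop where
  metrizable : TopologicalSpace.MetrizableSpace Y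
  exists_extension : ∀ (X : Type u) [TopologicalSpace X] [TopologicalSpace.MetrizableSpace X]
    (A : Set X), IsClosed A → ∀ ψ : C(A, Y),
      ∃ (A' : Set X) (hA : A ⊆ A'), IsOpen A' ∧
        ∃ ψ' : C(A', Y), ∀ a : A, ψ' (Set.inclusion hA a) = ψ a

/-! A contractible ANR is an absolute extensor for metrizable spaces. Hence a partial map into `L`
that respects the simplices of `N` extends over a whole space above `|N|`, one simplex at a time,
faces before cofaces (`exists_extension_of_isANR`). Over `|N|` itself, starting from nothing, this
yields `ι`; over `unitInterval × L`, starting from `ι ∘ ρ` and the identity at the two ends, it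
yields the homotopy between them. The other homotopy is a straight line, since `ρ (ι α)` and `α`
share a simplex. -/

theorem IsANR.exists_extension_of_contractible.{u, w} {Y : Type u} [TopologicalSpace Y]
    [ContractibleSpace Y] (hY : IsANR Y) {X : Type w} [Small.{u} X] [TopologicalSpace X]
    [TopologicalSpace.MetrizableSpace X] {A : Set X} (hA : IsClosed A) (f : C(A, Y)) :
    ∃ F : C(X, Y), ∀ a : A, F a = f a := by
  -- `IsANR` tests only spaces in the universe of `Y`, so `X` is replaced by a copy there.
  let e : X ≃ₜ Shrink.{u} X := Shrink.homeomorph X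
  have : TopologicalSpace.MetrizableSpace (Shrink.{u} X) := e.symm.isEmbedding.metrizableSpace
  let g : C(e.symm ⁻¹' A, Y) :=
    f.comp ⟨fun x => ⟨e.symm x, x.2⟩, by fun_prop⟩
  obtain ⟨U, hAU, hU, ψ, hψ⟩ := hY.exists_extension _ _ (hA.preimage e.symm.continuous) g
  obtain ⟨W, hW, hAW, hWU⟩ := normal_exists_closure_subset (hA.preimage e.symm.continuous) hU hAU
  obtain ⟨u, hu₀, hu₁, -⟩ := exists_continuous_zero_one_of_isClosed
    (hA.preimage e.symm.continuous) hW.isClosed_compl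
    (Set.disjoint_compl_right_iff_subset.2 hAW)
  obtain ⟨y₀, ⟨H⟩⟩ := id_nullhomotopic Y
  classical
  -- `H` contracts `Y` to `y₀`. Used at time `u`, it leaves `ψ` unchanged on `A`, where `u = 0`, and
  -- gives `y₀` on `U` outside `W`, where `u = 1`; so the constant `y₀` continues it beyond `U`.
  let G : Shrink.{u} X → Y := fun x =>
    if hx : x ∈ U then H (Set.projIcc 0 1 zero_le_one (u x), ψ ⟨x, hx⟩) else y₀
  have hGU : ContinuousOn G U := by
    rw [continuousOn_iff_continuous_domRestrict]
    have : U.domRestrict G =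
        fun x : U => H (Set.projIcc 0 1 zero_le_one (u x), ψ x) :=
      funext fun x => dif_pos x.2
    rw [this]
    fun_prop
  have hGW : ContinuousOn G (closure W)ᶜ := by
    refine continuousOn_const (c := y₀) |>.congr fun x hx => ?_
    have : u x = 1 := hu₁ fun h => hx (subset_closure h)
    by_cases hx : x ∈ U <;> simp [G, hx, this]
  have hG : Continuous G := by
    rw [← continuousOn_univ]
    refine (hGU.union_of_isOpen hGW hU isClosed_closure.isOpen_compl).mono fun x _ => ?_
    by_cases hx : x ∈ closure W
    · exact Or.inl (hWU hx)
    · exact Or.inr hx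
  refine ⟨⟨G ∘ e, by fun_prop⟩, fun a => ?_⟩
  have ha : e a ∈ e.symm ⁻¹' A := by simp
  have h₁ : u (e a) = 0 := hu₀ ha
  have h₂ : ψ ⟨e a, hAU ha⟩ = f a := by
    refine (hψ ⟨e a, ha⟩).trans ?_
    simp [g]
  simp [G, hAU ha, h₁, h₂]

namespace AbstractSimplicialComplex

variable {V : Type*} [Fintype V] {N : AbstractSimplicialComplex V}

theorem exists_mem_simplexRealization (α : N.realization) :
    ∃ σ ∈ N, α ∈ N.simplexRealization σ := by
  obtain ⟨σ, hσ, h⟩ := α.2.2.1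
  refine ⟨σ, hσ, fun v hv => ?_⟩
  by_contra hne
  exact hv (Finset.mem_coe.1 (h ▸ hne))

theorem isClosed_simplexRealization (σ : Finset V) : IsClosed (N.simplexRealization σ) := by
  simp only [simplexRealization, Set.ofPred_forall]
  exact isClosed_iInter fun v => isClosed_iInter fun _ => isClosed_eq
    ((continuous_apply v).comp continuous_subtype_val) continuous_const

theorem simplexRealization_mono {σ τ : Finset V} (h : σ ⊆ τ) :
    N.simplexRealization σ ⊆ N.simplexRealization τ :=
  fun _ hα v hv => hα v fun hσ => hv (h hσ)

/-- The intersection is nonempty because the coordinates of `α` sum to 1. -/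
theorem inter_mem_of_mem_simplexRealization [DecidableEq V] {σ τ : Finset V} (hσ : σ ∈ N)
    {α : N.realization} (hασ : α ∈ N.simplexRealization σ) (hατ : α ∈ N.simplexRealization τ) :
    σ ∩ τ ∈ N ∧ α ∈ N.simplexRealization (σ ∩ τ) := by
  have hα : α ∈ N.simplexRealization (σ ∩ τ) := fun v hv => by
    by_cases h : v ∈ σ
    · exact hατ v fun h' => hv (Finset.mem_inter.2 ⟨h, h'⟩)
    · exact hασ v h
  refine ⟨(N.isRelLowerSet_faces hσ).2 Finset.inter_subset_left ?_, hα⟩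
  rw [Finset.nonempty_iff_ne_empty]
  intro h
  have := α.2.2.2
  rw [Finset.sum_eq_zero fun v _ => hα v (by simp [h])] at this
  exact zero_ne_one this

/-- A partial map between spaces over `|N|` that respects the preimages of the simplices extends
to the whole source, provided that the preimages in the target are contractible ANRs. -/
theorem exists_extension_of_isANR.{u, w} {L : Type u} [TopologicalSpace L]
    (ρ : C(L, N.realization))
    (hcontr : ∀ σ ∈ N, ContractibleSpace ↥(ρ ⁻¹' N.simplexRealization σ))
    (hANR : ∀ σ ∈ N, IsANR ↥(ρ ⁻¹' N.simplexRealization σ))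
    {Z : Type w} [Small.{u} Z] [TopologicalSpace Z] (p : C(Z, N.realization))
    (hZ : ∀ σ ∈ N, TopologicalSpace.MetrizableSpace ↥(p ⁻¹' N.simplexRealization σ))
    {B : Set Z} (hB : IsClosed B) {f : Z → L} (hf : ContinuousOn f B)
    (hfσ : ∀ σ ∈ N, ∀ z ∈ B, p z ∈ N.simplexRealization σ → ρ (f z) ∈ N.simplexRealization σ) :
    ∃ F : C(Z, L), Set.EqOn F f B ∧
      ∀ σ ∈ N, ∀ z, p z ∈ N.simplexRealization σ → ρ (F z) ∈ N.simplexRealization σ := by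
  classical
  -- Induction over subcomplexes `S`: removing a maximal simplex leaves a subcomplex.
  have key : ∀ S : Finset (Finset V), (∀ σ ∈ S, σ ∈ N) →
      (∀ σ ∈ S, ∀ τ ∈ N, τ ⊆ σ → τ ∈ S) →
      ∃ F : Z → L, ContinuousOn F (B ∪ ⋃ σ ∈ S, p ⁻¹' N.simplexRealization σ) ∧ Set.EqOn F f B ∧
        ∀ σ ∈ S, ∀ z, p z ∈ N.simplexRealization σ → ρ (F z) ∈ N.simplexRealization σ := by
    intro S
    induction S using Finset.strongInduction with
    | H S ih =>
    intro hSN hS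
    rcases S.eq_empty_or_nonempty with rfl | hSne
    · exact ⟨f, by simpa using hf, fun _ _ => rfl, by simp⟩
    obtain ⟨σ, hσS, hσmax⟩ := S.exists_maximal hSne
    have hσN := hSN σ hσS
    obtain ⟨F, hFc, hFB, hFS⟩ := ih (S.erase σ) (Finset.erase_ssubset hσS)
      (fun τ hτ => hSN τ (Finset.mem_of_mem_erase hτ))
      (fun τ hτ τ' hτ' hsub => Finset.mem_erase.2
        ⟨by
          rintro rfl
          exact (Finset.mem_erase.1 hτ).1
            (le_antisymm (hσmax (Finset.mem_of_mem_erase hτ) hsub) hsub),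
        hS τ (Finset.mem_of_mem_erase hτ) τ' hτ' hsub⟩)
    set C : Set Z := B ∪ ⋃ τ ∈ S.erase σ, p ⁻¹' N.simplexRealization τ with hC
    have hCcl : IsClosed C := hB.union <| (S.erase σ).finite_toSet.isClosed_biUnion fun τ _ =>
      (isClosed_simplexRealization τ).preimage p.continuous
    have hσcl : IsClosed (p ⁻¹' N.simplexRealization σ) :=
      (isClosed_simplexRealization σ).preimage p.continuous
    -- By maximality, `σ` meets any other `τ` of `S` in a proper face of `σ`, where `F` already
    -- respects simplices. So `F` maps the part of `C` over `σ` into a contractible ANR.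
    have hFσ : ∀ z ∈ C, p z ∈ N.simplexRealization σ → ρ (F z) ∈ N.simplexRealization σ := by
      rintro z (hz | hz) hzσ
      · rw [hFB hz]
        exact hfσ σ hσN z hz hzσ
      · simp only [Set.mem_iUnion] at hz
        obtain ⟨τ, hτ, hzτ⟩ := hz
        obtain ⟨hN, hzi⟩ := inter_mem_of_mem_simplexRealization hσN hzσ hzτ
        have hτS := Finset.mem_of_mem_erase hτ
        refine simplexRealization_mono Finset.inter_subset_left (hFS (σ ∩ τ) ?_ z hzi)
        refine Finset.mem_erase.2 ⟨fun h => (Finset.mem_erase.1 hτ).1 ?_,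
          hS σ hσS _ hN Finset.inter_subset_left⟩
        have hsub := Finset.inter_eq_left.1 h
        exact le_antisymm (hσmax hτS hsub) hsub
    have := hcontr σ hσN
    have := hZ σ hσN
    have hF' : Continuous fun x : (Subtype.val ⁻¹' C : Set ↥(p ⁻¹' N.simplexRealization σ)) =>
        F x.1.1 :=
      hFc.comp_continuous (by fun_prop) fun x => x.2
    obtain ⟨G, hG⟩ := (hANR σ hσN).exists_extension_of_contractible
      (hCcl.preimage continuous_subtype_val)
      ⟨fun x : (Subtype.val ⁻¹' C : Set ↥(p ⁻¹' N.simplexRealization σ)) =>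
        (⟨F x.1.1, hFσ x.1.1 x.2 x.1.2⟩ : ↥(ρ ⁻¹' N.simplexRealization σ)), hF'.subtype_mk _⟩
    let F' : Z → L := fun z =>
      if hz : z ∈ p ⁻¹' N.simplexRealization σ then G ⟨z, hz⟩ else F z
    have hF'σ : ∀ z (hz : z ∈ p ⁻¹' N.simplexRealization σ), F' z = G ⟨z, hz⟩ :=
      fun z hz => dif_pos hz
    have hF'C : Set.EqOn F' F C := fun z hz => by
      by_cases hzσ : z ∈ p ⁻¹' N.simplexRealization σ
      · rw [hF'σ z hzσ, hG ⟨⟨z, hzσ⟩, hz⟩]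
        rfl
      · exact dif_neg hzσ
    refine ⟨F', ?_, fun z hz => (hF'C (Or.inl hz)).trans (hFB hz), fun τ hτ z hz => ?_⟩
    · have h₁ : ContinuousOn F' (p ⁻¹' N.simplexRealization σ) := by
        rw [continuousOn_iff_continuous_domRestrict]
        have : Set.domRestrict (p ⁻¹' N.simplexRealization σ) F' = fun z => (G z : L) :=
          funext fun z => hF'σ z z.2
        rw [this]
        fun_prop
      refine ((hFc.congr hF'C).union_of_isClosed h₁ hCcl hσcl).mono ?_
      rintro z (hz | hz)
      · exact Or.inl (Or.inl hz)
      · simp only [Set.mem_iUnion] at hz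
        obtain ⟨τ, hτ, hzτ⟩ := hz
        by_cases h : τ = σ
        · exact Or.inr (h ▸ hzτ)
        · exact Or.inl (Or.inr (Set.mem_biUnion (Finset.mem_erase.2 ⟨h, hτ⟩) hzτ))
    · by_cases h : τ = σ
      · subst h
        rw [hF'σ z hz]
        exact (G ⟨z, hz⟩).2
      · have hτ' := Finset.mem_erase.2 ⟨h, hτ⟩
        rw [hF'C (Or.inr (Set.mem_biUnion hτ' hz))]
        exact hFS τ hτ' z hz
  obtain ⟨F, hFc, hFB, hFS⟩ := key (Finset.univ.filter (· ∈ N)) (by simp)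
    (fun σ _ τ hτ _ => by simpa using hτ)
  have huniv : B ∪ ⋃ σ ∈ Finset.univ.filter (· ∈ N), p ⁻¹' N.simplexRealization σ = Set.univ := by
    refine Set.eq_univ_of_forall fun z => Or.inr ?_
    obtain ⟨σ, hσ, hz⟩ := exists_mem_simplexRealization (p z)
    exact Set.mem_biUnion (by simpa using hσ) hz
  rw [huniv, continuousOn_univ] at hFc
  exact ⟨⟨F, hFc⟩, hFB, fun σ hσ => hFS σ (by simpa using hσ)⟩

/-- Two maps to `|N|` that send each point into a common simplex are homotopic. -/
theorem homotopic_of_forall_exists_simplex {Z : Type*} [TopologicalSpace Z]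
    (f g : C(Z, N.realization))
    (h : ∀ z, ∃ σ ∈ N, f z ∈ N.simplexRealization σ ∧ g z ∈ N.simplexRealization σ) :
    f.Homotopic g := by
  have hmem : ∀ x : unitInterval × Z,
      AffineMap.lineMap (k := ℝ) (f x.2 : V → ℝ) (g x.2 : V → ℝ) (x.1 : ℝ) ∈ N.realization := by
    rintro ⟨t, z⟩
    obtain ⟨σ, hσ, hf, hg⟩ := h z
    have hsum : ∑ v, AffineMap.lineMap (k := ℝ) (f z : V → ℝ) (g z : V → ℝ) (t : ℝ) v = 1 := by
      simp only [AffineMap.lineMap_apply_module, Pi.add_apply, Pi.smul_apply, smul_eq_mul,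
        Finset.sum_add_distrib, ← Finset.mul_sum, (f z).2.2.2, (g z).2.2.2]
      ring
    refine ⟨fun v => ?_, ?_, hsum⟩
    · rw [AffineMap.pi_lineMap_apply]
      exact (convex_Icc (0 : ℝ) 1).lineMap_mem ((f z).2.1 v) ((g z).2.1 v) t.2
    -- The simplex is the support of the interpolated point, a nonempty subset of `σ`.
    · classical
      refine ⟨Finset.univ.filter fun v =>
        AffineMap.lineMap (k := ℝ) (f z : V → ℝ) (g z : V → ℝ) (t : ℝ) v ≠ 0,
        (N.isRelLowerSet_faces hσ).2 (fun v hv => ?_) ?_, by simp⟩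
      · by_contra hvσ
        simp [AffineMap.lineMap_apply_module, hf v hvσ, hg v hvσ] at hv
      · rw [Finset.nonempty_iff_ne_empty]
        intro hempty
        rw [Finset.sum_eq_zero fun v hv => by
          simpa using Finset.filter_eq_empty_iff.1 hempty hv] at hsum
        exact zero_ne_one hsum
  refine ⟨⟨⟨fun x => ⟨_, hmem x⟩, ?_⟩, fun z => ?_, fun z => ?_⟩⟩
  · refine Continuous.subtype_mk ?_ _
    simp only [AffineMap.lineMap_apply_module]
    fun_prop
  · simp
  · simp

end AbstractSimplicialComplex

theorem mainTheorem4 {V : Type*} [Fintype V] (N : AbstractSimplicialComplex V)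
    {L : Type*} [TopologicalSpace L] (ρ : C(L, N.realization)) (hρ : Function.Surjective ρ)
    (hcontr : ∀ σ ∈ N, ContractibleSpace ↥(ρ ⁻¹' N.simplexRealization σ))
    (hANR : ∀ σ ∈ N, IsANR ↥(ρ ⁻¹' N.simplexRealization σ)) :
    ∃ ι : C(N.realization, L),
      (ρ.comp ι).Homotopic (ContinuousMap.id N.realization) ∧
      (ι.comp ρ).Homotopic (ContinuousMap.id L) ∧
      ∀ σ ∈ N, ι '' N.simplexRealization σ ⊆ ρ ⁻¹' N.simplexRealization σ := by
  have : Countable V := Finite.to_countable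
  -- With `B = ∅`, any function can serve as `f`.
  obtain ⟨ι, -, hι⟩ := AbstractSimplicialComplex.exists_extension_of_isANR ρ hcontr hANR
    (ContinuousMap.id N.realization) (fun _ _ => inferInstance) (B := ∅) isClosed_empty
    (f := Function.surjInv hρ) (continuousOn_empty _) (by simp)
  obtain ⟨H, hHB, -⟩ := AbstractSimplicialComplex.exists_extension_of_isANR ρ hcontr hANR
    (Z := unitInterval × L) (ρ.comp ContinuousMap.snd) (fun σ hσ => by
      have := (hANR σ hσ).metrizable
      -- The part over `σ` embeds in the product of the interval with a metrizable preimage;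
      -- metrizability of `L` is not needed.
      let j : ↥((ρ.comp ContinuousMap.snd : C(unitInterval × L, N.realization)) ⁻¹'
          N.simplexRealization σ) → unitInterval × ↥(ρ ⁻¹' N.simplexRealization σ) :=
        fun x => (x.1.1, ⟨x.1.2, x.2⟩)
      have hj : Topology.IsEmbedding j := by
        refine Topology.IsEmbedding.of_comp (by fun_prop)
          (g := Prod.map id Subtype.val) (by fun_prop) ?_
        exact Topology.IsEmbedding.subtypeVal
      exact hj.metrizableSpace)
    (B := (Prod.fst ⁻¹' {0}) ∪ (Prod.fst ⁻¹' {1}))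
    ((isClosed_singleton.preimage continuous_fst).union
      (isClosed_singleton.preimage continuous_fst))
    (f := fun x => if x.1 = 0 then ι (ρ x.2) else x.2)
    (by
      refine ContinuousOn.union_of_isClosed ?_ ?_ (isClosed_singleton.preimage continuous_fst)
        (isClosed_singleton.preimage continuous_fst)
      · refine ContinuousOn.congr (f := fun x => ι (ρ x.2)) (by fun_prop) fun x hx =>
          if_pos (show x.1 = 0 from hx)
      · refine ContinuousOn.congr (f := Prod.snd) (by fun_prop) fun x hx => if_neg ?_
        rw [show x.1 = 1 from hx]
        exact one_ne_zero)
    (by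
      intro σ hσ x _ hx
      split_ifs
      · exact hι σ hσ _ hx
      · exact hx)
  refine ⟨ι, ?_, ⟨⟨H, fun x => ?_, fun x => ?_⟩⟩, ?_⟩
  · refine AbstractSimplicialComplex.homotopic_of_forall_exists_simplex _ _ fun α => ?_
    obtain ⟨σ, hσ, hα⟩ := AbstractSimplicialComplex.exists_mem_simplexRealization α
    exact ⟨σ, hσ, hι σ hσ α hα, hα⟩
  · simpa using hHB (x := (0, x)) (by simp)
  · simpa using hHB (x := (1, x)) (by simp)
  · rintro σ hσ _ ⟨α, hα, rfl⟩
    exact hι σ hσ α hα
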